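/- A seller posts a price to a buyer whose valuation has a distribution $F$ on $[0,\infty)$ (also denoting its cumulative distribution function). Write $F^{-1}(q)=\inf\{x: q\le F(x)\}$ for $0<q<1$. The revenue curve of $F$ is $R(q)=(1-q)F^{-1}(q)$, and $F$ is regular if $R$ is concave on $(0,1)$. Let $r(p)=p\,(1-F(p))$ and $r_F=\max_{p\ge 0} r(p)$ (the optimal revenue). Given two samples $s\ge t$, the Empirical Revenue Maximizing (ERM) mechanism posts $s$ if $s>2t$, posts $t$ if $s<2t$, and if $s=2t$ posts the one of $s,t$ with the smaller value of $r$; let $\psi_F(s,t)=\psi_F(t,s)$ be the resulting value of $r$. The revenue of the two-sample ERM mechanism is $\bar r_F=\int\int \psi_F(s,t)\,dF(s)\,dF(t)$. For integers $n\ge 1$ and $0\le k\le n$ put $q_i=i/n$ and $\bar q_i=(q_i+q_{i+1})/2$. A feasible (primal) solution of the mixed-integer linear program $P(n,k)$ consists of reals $R_i\in[0,1]$ $(0\le i\le n)$, $w_{ij}\in\{0,1\}$ and $X^{\ell}_{ij}\in[0,1]$ $(0\le j<i<n,\ \ell\in\{i,j\})$ such that, with $\bar R_i=(R_i+R_{i+1})/2$,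 for all indices for which the terms are defined: 1. $R_k=1$ and $R_i(q_{i+1}-q_{i-1})\ge R_{i+1}(q_i-q_{i-1})+R_{i-1}(q_{i+1}-q_i)$ for $0<i<n$; 2. $X^i_{ij}(1-\bar q_j)-2X^j_{ij}(1-\bar q_i)\ge 0$ and $(\bar R_i-X^i_{ij})(1-\bar q_j)-2(\bar R_j-X^j_{ij})(1-\bar q_i)\le 0$; 3. $X^\ell_{ij}\le w_{ij}$, $X^\ell_{ij}\le \bar R_\ell$, and $X^\ell_{ij}\ge \bar R_\ell+w_{ij}-1$; 4. $w_{ij}\le w_{i+1,j}$ and $w_{i,j+1}\le w_{ij}$. Let $\hat R$ be the piecewise-linear function on $[0,1]$ with vertices $(0,0)$, $(0.55,1)$, $(0.975,\,0.13622426631625)$, $(0.9875,\,0.0764989307155183)$, $(1,\,0.000592615495607213)$. **Theorem.** There is a feasible solution of $P(80,44)$ (so the peak is at $q_{OPT}=44/80$) with $|R_i-\hat R(i/80)|\le 10^{-3}$ for $0\le i\le 80$, and an atomless regular distribution $F$ on $[0,\infty)$ whose revenue curve on $(0,1)$ is the piecewise-linear interpolation of the values $R_i$ at $i/80$, such that $r_F$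 is attained, $0<r_F<\infty$, $\psi_F$ is integrable with respect to $F\times F$, and $$\bar r_F\ \le\ 0.61035\; r_F .$$ -/

import Mathlib

open MeasureTheory ProbabilityTheory Set

namespace TwoSampleERM

noncomputable section

/-! ### Posted prices and regular distributions -/

/-- A distribution of the buyer's valuation: a probability measure carried by `[0, ∞)`. -/
def IsValuation (F : Measure ℝ) : Prop :=
  IsProbabilityMeasure F ∧ F (Iio 0) = 0

/-- Expected revenue `r(p) = p (1 - F(p))` of posting the price `p`. -/
def priceRevenue (F : Measure ℝ) (p : ℝ) : ℝ :=
  p * (1 - cdf F p)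

/-- The price inverse (quantile function) `F⁻¹(q) = inf {x | q ≤ F(x)}`, meaningful for `0 < q < 1`. -/
def priceInverse (F : Measure ℝ) (q : ℝ) : ℝ :=
  sInf {x : ℝ | q ≤ cdf F x}

/-- The revenue curve `R(q) = (1 - q) F⁻¹(q)`. -/
def revenueCurve (F : Measure ℝ) (q : ℝ) : ℝ :=
  (1 - q) * priceInverse F q

/-- A valuation distribution is regular if its revenue curve is concave on `(0, 1)`. -/
def IsRegular (F : Measure ℝ) : Prop :=
  IsValuation F ∧ ConcaveOn ℝ (Ioo 0 1) (revenueCurve F)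

/-- The optimal revenue, the supremum of `r(p)` over all prices `p ≥ 0`. -/
def optimalRevenue (F : Measure ℝ) : ℝ :=
  sSup (priceRevenue F '' Ici 0)

/-- Expected revenue of the ERM mechanism given the two samples `s` and `t`: the larger sample is
posted if it exceeds twice the smaller one, the smaller one is posted if the larger one is less than
twice the smaller one, and a tie is broken in favour of the smaller revenue. -/
def bisampleRevenue (F : Measure ℝ) (s t : ℝ) : ℝ :=
  if 2 * min s t < max s t then priceRevenue F (max s t)
  else if max s t < 2 * min s t then priceRevenue F (min s t)
  else min (priceRevenue F (max s t)) (priceRevenue F (min s t))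

/-- Expected revenue of the ERM mechanism with two independent samples from `F`. -/
def ermRevenue (F : Measure ℝ) : ℝ :=
  ∫ z : ℝ × ℝ, bisampleRevenue F z.1 z.2 ∂(F.prod F)

/-! ### The mixed-integer linear program on the uniform grid

The grid points are `q_i = i / n` for `0 ≤ i ≤ n`, and the midpoint of the `i`-th interval
`[q_i, q_{i+1}]` is `q̄_i`, for `0 ≤ i < n`. -/

/-- Grid point `q_i`. -/
def node (n i : ℕ) : ℝ := (i : ℝ) / n

/-- Midpoint `q̄_i` of the interval `[q_i, q_{i+1}]`. -/
def midpt (n i : ℕ) : ℝ := (node n i + node n (i + 1)) / 2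

/-- The variables of the program: `R i` stands for `R(q_i)` with `i ≤ n`, `w i j` for the indicator
`w(q̄_i, q̄_j)` with `j < i < n`, and `Rw l i j` for the product `R(q̄_l) w(q̄_i, q̄_j)` with
`j < i < n` and `l ∈ {i, j}`. Values at other indices play no role. -/
structure MILPPoint where
  R : ℕ → ℝ
  w : ℕ → ℕ → ℝ
  Rw : ℕ → ℕ → ℕ → ℝ

/-- `R(q̄_i)`, by linear interpolation. -/
def MILPPoint.Rmid (s : MILPPoint) (i : ℕ) : ℝ := (s.R i + s.R (i + 1)) / 2

/-- `s` is a (primal) feasible solution of the program with `n` intervals and peak at `q_k`. -/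
structure MILPPoint.Feasible (s : MILPPoint) (n k : ℕ) : Prop where
  /-- concavity of the revenue curve on the grid -/
  concave : ∀ i, i + 2 ≤ n →
    s.R (i + 2) * (node n (i + 1) - node n i) + s.R i * (node n (i + 2) - node n (i + 1)) ≤
      s.R (i + 1) * (node n (i + 2) - node n i)
  /-- linearization of `w [R(x) (1 - y) - 2 R(y) (1 - x)] ≥ 0` at `(x, y) = (q̄_i, q̄_j)` -/
  w_one : ∀ i j, j < i → i < n →
    0 ≤ s.Rw i i j * (1 - midpt n j) - 2 * s.Rw j i j * (1 - midpt n i)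
  /-- linearization of `(1 - w) [R(x) (1 - y) - 2 R(y) (1 - x)] ≤ 0` at `(x, y) = (q̄_i, q̄_j)` -/
  w_zero : ∀ i j, j < i → i < n →
    (s.Rmid i - s.Rw i i j) * (1 - midpt n j) - 2 * (s.Rmid j - s.Rw j i j) * (1 - midpt n i) ≤ 0
  Rw_le_w : ∀ i j l, j < i → i < n → (l = i ∨ l = j) → s.Rw l i j ≤ s.w i j
  Rw_le_R : ∀ i j l, j < i → i < n → (l = i ∨ l = j) → s.Rw l i j ≤ s.Rmid l
  le_Rw : ∀ i j l, j < i → i < n → (l = i ∨ l = j) → s.Rmid l + s.w i j - 1 ≤ s.Rw l i j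
  w_mono_left : ∀ i j, j < i → i + 1 < n → s.w i j ≤ s.w (i + 1) j
  w_mono_right : ∀ i j, j + 1 < i → i < n → s.w i (j + 1) ≤ s.w i j
  peak_le : k ≤ n
  peak : s.R k = 1
  R_mem : ∀ i, i ≤ n → s.R i ∈ Icc (0 : ℝ) 1
  w_binary : ∀ i j, j < i → i < n → s.w i j = 0 ∨ s.w i j = 1
  Rw_mem : ∀ i j l, j < i → i < n → (l = i ∨ l = j) → s.Rw l i j ∈ Icc (0 : ℝ) 1

/-- The piecewise-linear function on `[0, 1]` that takes the value `a i` at `i / n` for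
`0 ≤ i ≤ n` and is affine on each interval `[i / n, (i + 1) / n]`. -/
def interpolate (n : ℕ) (a : ℕ → ℝ) (q : ℝ) : ℝ :=
  a ⌊n * q⌋₊ * (1 - (n * q - ⌊n * q⌋₊)) + a (⌊n * q⌋₊ + 1) * (n * q - ⌊n * q⌋₊)

/-- The reported values at `i / 80` of the revenue curve for `n = 80` and peak `44 / 80`: affine
from `0` to `44 / 80` and from `44 / 80` to `78 / 80`. -/
def reportedCurve (i : ℕ) : ℝ :=
  if i ≤ 44 then (i : ℝ) / 44
  else if i ≤ 78 then 1 - (1 - 0.13622426631625) * ((i : ℝ) - 44) / 34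
  else if i = 79 then 0.0764989307155183
  else 0.000592615495607213

end

end TwoSampleERM

/-!
The distribution is that of `v(U)` for `U` uniform on `(0, 1)` and `v(q) = R(q) / (1 - q)`, where `R`
is a concave curve with four affine pieces and maximum `1` (`curve`). As `v` is continuous and
strictly increasing, the price inverse is `v`, the revenue curve is `R`, there are no atoms, and
posting the price `v(q)` earns `R(q)`, so that the optimal revenue is `1`. Sampling `R` at the grid
points, and setting `w i j = 1` if the price at the midpoint of interval `i` is at least twice that
of interval `j`, solves the program: all its constraints follow from the concavity of `R` and the
monotonicity of `v` (`solution_feasible`).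

By symmetry, the ERM revenue is twice the integral over `y` of the conditional contribution
`(c - y) R(y) + ∫ x in c..1, R x` of the pairs of quantiles `x ≥ y`, where `v(c) = 2 v(y)`
(`ermRevenue_quantileLaw_le`, `integral_orderedRevenue_price_le`). Where `R` is affine both at `y`
and at `c`, the quantile `c` is a Möbius function of `y`, and the contribution has an elementary
antiderivative that involves one logarithm (`integral_conditional_le_pieceValue`). Cutting `(0, 1)`
into five such intervals and a short tail, and bounding the five logarithms by their power series,
gives at most `0.61034` (`ermRevenue_price_le`).
-/

namespace TwoSampleERM

/-! ### Distributions given by their price inverse -/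

/-- The distribution of `v(U)` for `U` uniform on `(0, 1)`. -/
noncomputable def quantileLaw (v : ℝ → ℝ) : Measure ℝ :=
  (volume.restrict (Ioo (0 : ℝ) 1)).map v

instance : IsProbabilityMeasure (volume.restrict (Ioo (0 : ℝ) 1)) :=
  ⟨by simp⟩

section quantileLaw

variable {v : ℝ → ℝ}

theorem isProbabilityMeasure_quantileLaw (hv : Measurable v) :
    IsProbabilityMeasure (quantileLaw v) :=
  Measure.isProbabilityMeasure_map hv.aemeasurable

theorem quantileLaw_apply (hv : Measurable v) {s : Set ℝ} (hs : MeasurableSet s) :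
    quantileLaw v s = volume (v ⁻¹' s ∩ Ioo 0 1) := by
  rw [quantileLaw, Measure.map_apply hv hs, Measure.restrict_apply (hv hs)]

theorem isValuation_quantileLaw (hv : Measurable v) (hpos : ∀ q ∈ Ioo (0 : ℝ) 1, 0 ≤ v q) :
    IsValuation (quantileLaw v) := by
  refine ⟨isProbabilityMeasure_quantileLaw hv, ?_⟩
  rw [quantileLaw_apply hv measurableSet_Iio]
  convert measure_empty (μ := (volume : Measure ℝ))
  ext q
  simp only [mem_inter_iff, mem_preimage, mem_Iio, mem_empty_iff_false, iff_false, not_and]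
  exact fun h hq => absurd (hpos q hq) (not_le.2 h)

theorem quantileLaw_singleton (hv : Measurable v) (hmono : StrictMonoOn v (Ioo 0 1)) (x : ℝ) :
    quantileLaw v {x} = 0 := by
  rw [quantileLaw_apply hv (measurableSet_singleton x)]
  refine Set.Subsingleton.measure_zero ?_ _
  rintro p ⟨hp, hp1⟩ q ⟨hq, hq1⟩
  exact hmono.injOn hp1 hq1 (hp.trans hq.symm)

theorem cdf_quantileLaw (hv : Measurable v) (p : ℝ) :
    cdf (quantileLaw v) p = volume.real (v ⁻¹' Iic p ∩ Ioo 0 1) := by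
  have := isProbabilityMeasure_quantileLaw hv
  rw [cdf_eq_real, measureReal_def, quantileLaw_apply hv measurableSet_Iic, measureReal_def]

theorem cdf_quantileLaw_le (hv : Measurable v) (hmono : StrictMonoOn v (Ioo 0 1)) {p q : ℝ}
    (hq : q ∈ Ioo (0 : ℝ) 1) (hp : p ≤ v q) : cdf (quantileLaw v) p ≤ q := by
  rw [cdf_quantileLaw hv]
  have hsub : v ⁻¹' Iic p ∩ Ioo 0 1 ⊆ Ioc 0 q := by
    rintro x ⟨hx, hx1⟩
    exact ⟨hx1.1, (hmono.le_iff_le hx1 hq).1 (le_trans hx hp)⟩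
  calc _ ≤ volume.real (Ioc 0 q) := measureReal_mono hsub (by simp)
    _ = q := by simp [hq.1.le]

theorem le_cdf_quantileLaw (hv : Measurable v) {p q : ℝ} (hq0 : 0 ≤ q) (hq1 : q < 1)
    (h : ∀ x, 0 < x → x ≤ q → v x ≤ p) : q ≤ cdf (quantileLaw v) p := by
  rw [cdf_quantileLaw hv]
  have hsub : Ioc 0 q ⊆ v ⁻¹' Iic p ∩ Ioo 0 1 := fun x hx =>
    ⟨h x hx.1 hx.2, hx.1, hx.2.trans_lt hq1⟩
  calc q = volume.real (Ioc 0 q) := by simp [hq0]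
    _ ≤ _ := measureReal_mono hsub
      (measure_ne_top_of_subset inter_subset_right (by simp))

theorem cdf_quantileLaw_apply (hv : Measurable v) (hmono : StrictMonoOn v (Ioo 0 1)) {q : ℝ}
    (hq : q ∈ Ioo (0 : ℝ) 1) : cdf (quantileLaw v) (v q) = q :=
  le_antisymm (cdf_quantileLaw_le hv hmono hq le_rfl) <|
    le_cdf_quantileLaw hv hq.1.le hq.2 fun _ hx hxq =>
      (hmono.le_iff_le ⟨hx, hxq.trans_lt hq.2⟩ hq).2 hxq

theorem priceRevenue_quantileLaw_apply (hv : Measurable v) (hmono : StrictMonoOn v (Ioo 0 1))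
    {q : ℝ} (hq : q ∈ Ioo (0 : ℝ) 1) :
    priceRevenue (quantileLaw v) (v q) = v q * (1 - q) := by
  rw [priceRevenue, cdf_quantileLaw_apply hv hmono hq]

theorem priceInverse_quantileLaw (hv : Measurable v) (hmono : StrictMonoOn v (Ioo 0 1))
    (hcont : ContinuousOn v (Ioo 0 1)) {q : ℝ} (hq : q ∈ Ioo (0 : ℝ) 1) :
    priceInverse (quantileLaw v) q = v q := by
  refine IsLeast.csInf_eq ⟨(cdf_quantileLaw_apply hv hmono hq).ge, fun p hp => ?_⟩
  by_contra! hlt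
  -- by continuity `p` is also below `v x` for some `x < q`, so that its quantile is at most `x`
  have hev : ∀ᶠ x in nhds q, p < v x :=
    (hcont.continuousAt (isOpen_Ioo.mem_nhds hq)).eventually (lt_mem_nhds hlt)
  obtain ⟨δ, hδ, hball⟩ := Metric.eventually_nhds_iff.1 hev
  have hε : 0 < min (δ / 2) (q / 2) := lt_min (by linarith) (by linarith [hq.1])
  have hlt' : p < v (q - min (δ / 2) (q / 2)) := by
    apply hball
    rw [Real.dist_eq, sub_sub_cancel_left, abs_neg, abs_of_pos hε]
    linarith [min_le_left (δ / 2) (q / 2)]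
  have hmem : q - min (δ / 2) (q / 2) ∈ Ioo (0 : ℝ) 1 :=
    ⟨by linarith [min_le_right (δ / 2) (q / 2), hq.1], by linarith [hq.2]⟩
  have := cdf_quantileLaw_le hv hmono hmem hlt'.le
  have hp' : q ≤ cdf (quantileLaw v) p := hp
  linarith

/-- If `v(q) (1 - q) ≤ 1` for all quantiles, then no price earns more than `1`: at least
a fraction `1 - 1/p` of the buyers has a valuation of at most `p`. -/
theorem priceRevenue_quantileLaw_le_one (hv : Measurable v)
    (hle : ∀ q ∈ Ioo (0 : ℝ) 1, v q * (1 - q) ≤ 1) (p : ℝ) :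
    priceRevenue (quantileLaw v) p ≤ 1 := by
  have h0 := cdf_nonneg (quantileLaw v) p
  have h1 := cdf_le_one (quantileLaw v) p
  rw [priceRevenue]
  rcases le_total p 1 with hp | hp
  · nlinarith
  have hp0 : 0 < p := by linarith
  have hinv : p⁻¹ ≤ 1 := inv_le_one_of_one_le₀ hp
  have hinv0 : 0 < p⁻¹ := inv_pos.2 hp0
  have hcancel : p * p⁻¹ = 1 := mul_inv_cancel₀ hp0.ne'
  have hcdf : 1 - p⁻¹ ≤ cdf (quantileLaw v) p := by
    refine le_cdf_quantileLaw hv (by linarith) (by linarith) fun x hx hxq => ?_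
    have hx1 : x < 1 := by linarith
    have hvx := hle x ⟨hx, hx1⟩
    by_contra! hpx
    nlinarith [mul_le_mul_of_nonneg_left (show p⁻¹ ≤ 1 - x by linarith) hp0.le,
      mul_lt_mul_of_pos_right hpx (show 0 < 1 - x by linarith)]
  nlinarith [mul_le_mul_of_nonneg_left hcdf hp0.le]

theorem ae_quantileLaw_nonneg (hv : Measurable v) (hpos : ∀ q ∈ Ioo (0 : ℝ) 1, 0 ≤ v q) :
    ∀ᵐ x ∂quantileLaw v, 0 ≤ x := by
  have h := (isValuation_quantileLaw hv hpos).2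
  simpa only [ae_iff, not_le] using! h

end quantileLaw

theorem priceRevenue_nonneg (F : Measure ℝ) {p : ℝ} (hp : 0 ≤ p) : 0 ≤ priceRevenue F p :=
  mul_nonneg hp (sub_nonneg.2 (cdf_le_one F p))

theorem measurable_priceRevenue (F : Measure ℝ) : Measurable (priceRevenue F) :=
  measurable_id.mul (measurable_const.sub (monotone_cdf F).measurable)

theorem measurable_bisampleRevenue (F : Measure ℝ) :
    Measurable fun z : ℝ × ℝ => bisampleRevenue F z.1 z.2 := by
  have hmax : Measurable fun z : ℝ × ℝ => max z.1 z.2 := measurable_fst.max measurable_snd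
  have hmin : Measurable fun z : ℝ × ℝ => min z.1 z.2 := measurable_fst.min measurable_snd
  have hr := measurable_priceRevenue F
  unfold bisampleRevenue
  exact Measurable.ite (measurableSet_lt (hmin.const_mul 2) hmax) (hr.comp hmax) <|
    Measurable.ite (measurableSet_lt hmax (hmin.const_mul 2)) (hr.comp hmin)
      ((hr.comp hmax).min (hr.comp hmin))

theorem bisampleRevenue_mem_Icc {F : Measure ℝ} (hF : ∀ p, priceRevenue F p ≤ 1) {s t : ℝ}
    (hs : 0 ≤ s) (ht : 0 ≤ t) : bisampleRevenue F s t ∈ Icc (0 : ℝ) 1 := by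
  have hmax := priceRevenue_nonneg F (le_max_of_le_left hs : 0 ≤ max s t)
  have hmin := priceRevenue_nonneg F (le_min hs ht)
  unfold bisampleRevenue
  split_ifs
  · exact ⟨hmax, hF _⟩
  · exact ⟨hmin, hF _⟩
  · exact ⟨le_min hmax hmin, (min_le_left _ _).trans (hF _)⟩

theorem bisampleRevenue_comm (F : Measure ℝ) (s t : ℝ) :
    bisampleRevenue F s t = bisampleRevenue F t s := by
  simp only [bisampleRevenue, max_comm, min_comm]

theorem integrable_bisampleRevenue {v : ℝ → ℝ} (hv : Measurable v)
    (hpos : ∀ q ∈ Ioo (0 : ℝ) 1, 0 ≤ v q) (hle : ∀ q ∈ Ioo (0 : ℝ) 1, v q * (1 - q) ≤ 1) :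
    Integrable (fun z : ℝ × ℝ => bisampleRevenue (quantileLaw v) z.1 z.2)
      ((quantileLaw v).prod (quantileLaw v)) := by
  have := isProbabilityMeasure_quantileLaw hv
  refine Integrable.of_bound (measurable_bisampleRevenue _).aestronglyMeasurable 1 ?_
  have h := ae_quantileLaw_nonneg hv hpos
  filter_upwards [Measure.quasiMeasurePreserving_fst.ae h,
    Measure.quasiMeasurePreserving_snd.ae h] with z h1 h2
  obtain ⟨h3, h4⟩ := bisampleRevenue_mem_Icc (priceRevenue_quantileLaw_le_one hv hle) h1 h2
  rwa [Real.norm_of_nonneg h3]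

/-! ### Reduction of the ERM revenue to an integral over quantiles -/

/-- Revenue at the quantiles `x ≥ y` of the two samples, where ties are resolved by posting the
smaller sample; it vanishes for `x < y`. -/
noncomputable def orderedRevenue (v : ℝ → ℝ) (x y : ℝ) : ℝ :=
  if x < y then 0 else if 2 * v y < v x then v x * (1 - x) else v y * (1 - y)

section orderedRevenue

variable {v : ℝ → ℝ}

theorem measurable_orderedRevenue (hv : Measurable v) :
    Measurable fun z : ℝ × ℝ => orderedRevenue v z.1 z.2 := by
  have h1 : Measurable fun z : ℝ × ℝ => v z.1 := hv.comp measurable_fst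
  have h2 : Measurable fun z : ℝ × ℝ => v z.2 := hv.comp measurable_snd
  unfold orderedRevenue
  exact Measurable.ite (measurableSet_lt measurable_fst measurable_snd) measurable_const <|
    Measurable.ite (measurableSet_lt (h2.const_mul 2) h1)
      (h1.mul (measurable_const.sub measurable_fst)) (h2.mul (measurable_const.sub measurable_snd))

theorem orderedRevenue_mem_Icc (hpos : ∀ q ∈ Ioo (0 : ℝ) 1, 0 ≤ v q)
    (hle : ∀ q ∈ Ioo (0 : ℝ) 1, v q * (1 - q) ≤ 1) {x y : ℝ} (hx : x ∈ Ioo (0 : ℝ) 1)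
    (hy : y ∈ Ioo (0 : ℝ) 1) : orderedRevenue v x y ∈ Icc (0 : ℝ) 1 := by
  unfold orderedRevenue
  split_ifs
  · simp
  · exact ⟨mul_nonneg (hpos x hx) (by linarith [hx.2]), hle x hx⟩
  · exact ⟨mul_nonneg (hpos y hy) (by linarith [hy.2]), hle y hy⟩

theorem bisampleRevenue_le_orderedRevenue (hv : Measurable v) (hmono : StrictMonoOn v (Ioo 0 1))
    {x y : ℝ} (hx : x ∈ Ioo (0 : ℝ) 1) (hy : y ∈ Ioo (0 : ℝ) 1) (hxy : y ≤ x) :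
    bisampleRevenue (quantileLaw v) (v x) (v y) ≤ orderedRevenue v x y := by
  have hvxy : v y ≤ v x := (hmono.le_iff_le hy hx).2 hxy
  rw [bisampleRevenue, orderedRevenue, max_eq_left hvxy, min_eq_right hvxy,
    priceRevenue_quantileLaw_apply hv hmono hx, priceRevenue_quantileLaw_apply hv hmono hy,
    if_neg hxy.not_gt]
  split_ifs
  · rfl
  · rfl
  · exact min_le_right _ _

theorem ae_prod_mem_Ioo : ∀ᵐ z : ℝ × ℝ ∂(volume.restrict (Ioo (0 : ℝ) 1)).prod
    (volume.restrict (Ioo (0 : ℝ) 1)), z.1 ∈ Ioo (0 : ℝ) 1 ∧ z.2 ∈ Ioo (0 : ℝ) 1 := by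
  have h : ∀ᵐ x ∂volume.restrict (Ioo (0 : ℝ) 1), x ∈ Ioo (0 : ℝ) 1 :=
    ae_restrict_mem measurableSet_Ioo
  filter_upwards [Measure.quasiMeasurePreserving_fst.ae h,
    Measure.quasiMeasurePreserving_snd.ae h] with z h1 h2 using ⟨h1, h2⟩

theorem integrable_orderedRevenue (hv : Measurable v) (hpos : ∀ q ∈ Ioo (0 : ℝ) 1, 0 ≤ v q)
    (hle : ∀ q ∈ Ioo (0 : ℝ) 1, v q * (1 - q) ≤ 1) :
    Integrable (fun z : ℝ × ℝ => orderedRevenue v z.1 z.2)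
      ((volume.restrict (Ioo (0 : ℝ) 1)).prod (volume.restrict (Ioo (0 : ℝ) 1))) := by
  refine Integrable.of_bound (measurable_orderedRevenue hv).aestronglyMeasurable 1 ?_
  filter_upwards [ae_prod_mem_Ioo] with z hz
  obtain ⟨h3, h4⟩ := orderedRevenue_mem_Icc hpos hle hz.1 hz.2
  rwa [Real.norm_of_nonneg h3]

/-- By symmetry, the ERM revenue is twice the contribution of the samples whose quantiles satisfy
`x ≥ y`. -/
theorem ermRevenue_quantileLaw_le (hv : Measurable v) (hmono : StrictMonoOn v (Ioo 0 1))
    (hpos : ∀ q ∈ Ioo (0 : ℝ) 1, 0 ≤ v q) (hle : ∀ q ∈ Ioo (0 : ℝ) 1, v q * (1 - q) ≤ 1) :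
    ermRevenue (quantileLaw v) ≤
      2 * ∫ y in (0 : ℝ)..1, ∫ x in (0 : ℝ)..1, orderedRevenue v x y := by
  have hint := integrable_orderedRevenue hv hpos hle
  have hbi := integrable_bisampleRevenue hv hpos hle
  have hmp : Measurable (Prod.map v v) := hv.prodMap hv
  have hprod : (quantileLaw v).prod (quantileLaw v) =
      ((volume.restrict (Ioo (0 : ℝ) 1)).prod (volume.restrict (Ioo (0 : ℝ) 1))).map
        (Prod.map v v) := Measure.map_prod_map _ _ hv hv
  rw [hprod] at hbi
  rw [ermRevenue, hprod, integral_map hmp.aemeasurable hbi.aestronglyMeasurable]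
  calc _ ≤ ∫ z : ℝ × ℝ, orderedRevenue v z.1 z.2 + orderedRevenue v z.2 z.1
        ∂(volume.restrict (Ioo (0 : ℝ) 1)).prod (volume.restrict (Ioo (0 : ℝ) 1)) := by
        refine integral_mono_ae (hbi.comp_measurable hmp) (hint.add hint.swap) ?_
        filter_upwards [ae_prod_mem_Ioo] with z hz
        have h1 := (orderedRevenue_mem_Icc hpos hle hz.1 hz.2).1
        have h2 := (orderedRevenue_mem_Icc hpos hle hz.2 hz.1).1
        rcases le_total z.2 z.1 with h | h
        · have := bisampleRevenue_le_orderedRevenue hv hmono hz.1 hz.2 h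
          simp only [Prod.map_fst, Prod.map_snd]
          linarith
        · have := bisampleRevenue_le_orderedRevenue hv hmono hz.2 hz.1 h
          simp only [Prod.map_fst, Prod.map_snd]
          rw [bisampleRevenue_comm]
          linarith
    _ = 2 * ∫ z : ℝ × ℝ, orderedRevenue v z.1 z.2
        ∂(volume.restrict (Ioo (0 : ℝ) 1)).prod (volume.restrict (Ioo (0 : ℝ) 1)) := by
        rw [two_mul]
        refine (integral_add hint hint.swap).trans ?_
        congr 1
        exact integral_prod_swap (fun z : ℝ × ℝ => orderedRevenue v z.1 z.2)
    _ = _ := by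
        rw [integral_prod_symm _ hint]
        simp only [intervalIntegral.integral_of_le zero_le_one, integral_Ioc_eq_integral_Ioo]

theorem intervalIntegrable_orderedRevenue (hv : Measurable v)
    (hpos : ∀ q ∈ Ioo (0 : ℝ) 1, 0 ≤ v q) (hle : ∀ q ∈ Ioo (0 : ℝ) 1, v q * (1 - q) ≤ 1)
    {y : ℝ} (hy : y ∈ Ioo (0 : ℝ) 1) :
    IntervalIntegrable (fun x => orderedRevenue v x y) volume 0 1 := by
  rw [intervalIntegrable_iff_integrableOn_Ioo_of_le zero_le_one]
  refine Integrable.of_bound ((measurable_orderedRevenue hv).comp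
    (measurable_id.prodMk measurable_const)).aestronglyMeasurable 1 ?_
  filter_upwards [ae_restrict_mem measurableSet_Ioo] with x hx
  obtain ⟨h3, h4⟩ := orderedRevenue_mem_Icc hpos hle hx hy
  rwa [Real.norm_of_nonneg h3]

theorem intervalIntegrable_integral_orderedRevenue (hv : Measurable v)
    (hpos : ∀ q ∈ Ioo (0 : ℝ) 1, 0 ≤ v q) (hle : ∀ q ∈ Ioo (0 : ℝ) 1, v q * (1 - q) ≤ 1) :
    IntervalIntegrable (fun y => ∫ x in (0 : ℝ)..1, orderedRevenue v x y) volume 0 1 := by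
  rw [intervalIntegrable_iff_integrableOn_Ioo_of_le zero_le_one]
  simpa only [intervalIntegral.integral_of_le zero_le_one, integral_Ioc_eq_integral_Ioo] using!
    (integrable_orderedRevenue hv hpos hle).integral_prod_right

/-- A bound for the contribution of the lower quantile `y`: the revenue of `y` is earned while the
higher quantile is at most `c`, and that of the higher quantile afterwards. -/
theorem integral_orderedRevenue_le {R : ℝ → ℝ} (hR : Continuous R) (hv : Measurable v)
    (hpos : ∀ q ∈ Ioo (0 : ℝ) 1, 0 ≤ v q) (hle : ∀ q ∈ Ioo (0 : ℝ) 1, v q * (1 - q) ≤ 1)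
    {y c : ℝ} (hy : y ∈ Ioo (0 : ℝ) 1) (hyc : y ≤ c) (hc : c ≤ 1)
    (h1 : ∀ x ∈ Ioo y c, orderedRevenue v x y ≤ R y)
    (h2 : ∀ x ∈ Ioo c 1, orderedRevenue v x y ≤ R x) :
    ∫ x in (0 : ℝ)..1, orderedRevenue v x y ≤ (c - y) * R y + ∫ x in c..1, R x := by
  have hi := intervalIntegrable_orderedRevenue hv hpos hle hy
  have hi' : ∀ {a b : ℝ}, 0 ≤ a → a ≤ b → b ≤ 1 →
      IntervalIntegrable (fun x => orderedRevenue v x y) volume a b := fun ha hab hb =>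
    hi.mono_set (by rw [uIcc_of_le hab, uIcc_of_le zero_le_one]; exact Icc_subset_Icc ha hb)
  have hi1 := hi' le_rfl hy.1.le hy.2.le
  have hi2 := hi' hy.1.le hyc hc
  have hi3 := hi' (hy.1.le.trans hyc) hc le_rfl
  rw [← intervalIntegral.integral_add_adjacent_intervals (hi1.trans hi2) hi3,
    ← intervalIntegral.integral_add_adjacent_intervals hi1 hi2]
  have e1 := intervalIntegral.integral_mono_on_of_le_Ioo hy.1.le hi1
    (intervalIntegrable_const (c := (0 : ℝ)))
    (fun x hx => by rw [orderedRevenue, if_pos hx.2])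
  have e2 := intervalIntegral.integral_mono_on_of_le_Ioo hyc hi2
    (intervalIntegrable_const (c := R y)) h1
  have e3 := intervalIntegral.integral_mono_on_of_le_Ioo hc hi3 (hR.intervalIntegrable _ _) h2
  rw [intervalIntegral.integral_const, smul_eq_mul] at e1 e2
  linarith

end orderedRevenue

/-! ### The revenue curve -/

/-- The revenue curve of the constructed distribution, the lower envelope of four lines, called
rising, falling, steep and final, that cross at the quantiles `44/80`, `78/80` and `79/80`. Its
values at the grid points are within `1/1000` of the reported ones but differ from them, since the
reported curve itself has an ERM revenue of about `0.610356`. Every line `a + b (1 - q)` has `a > 0`,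
so that the price `a / (1 - q) + b` is strictly increasing and the distribution has no atom. -/
noncomputable def curve (q : ℝ) : ℝ :=
  min (min (20 / 11 * q) (0.0847 + 2.034 * (1 - q)))
    (min (0.01645 + 4.764 * (1 - q)) (0.0015 + 5.96 * (1 - q)))

theorem curve_of_le_peak {q : ℝ} (h : q ≤ 11 / 20) : curve q = 20 / 11 * q := by
  rw [curve, min_eq_left (a := 20 / 11 * q) (by linarith),
    min_eq_left (le_min (by linarith) (by linarith))]

theorem curve_of_mem_falling {q : ℝ} (h : q ∈ Icc (11 / 20 : ℝ) (39 / 40)) :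
    curve q = 0.0847 + 2.034 * (1 - q) := by
  obtain ⟨h1, h2⟩ := h
  rw [curve, min_eq_right (a := 20 / 11 * q) (by linarith),
    min_eq_left (le_min (by linarith) (by linarith))]

theorem curve_of_mem_steep {q : ℝ} (h : q ∈ Icc (39 / 40 : ℝ) (79 / 80)) :
    curve q = 0.01645 + 4.764 * (1 - q) := by
  obtain ⟨h1, h2⟩ := h
  rw [curve, min_eq_left (b := 0.0015 + _) (by linarith),
    min_eq_right (le_min (by linarith) (by linarith))]

theorem curve_of_mem_final {q : ℝ} (h : 79 / 80 ≤ q) : curve q = 0.0015 + 5.96 * (1 - q) := by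
  rw [curve, min_eq_right (b := 0.0015 + _) (by linarith),
    min_eq_right (le_min (by linarith) (by linarith))]

theorem continuous_curve : Continuous curve := by
  unfold curve
  fun_prop

theorem concaveOn_line (a b : ℝ) : ConcaveOn ℝ univ fun q : ℝ => a + b * (1 - q) :=
  ⟨convex_univ, fun x _ y _ s t _ _ hst => le_of_eq <| by
    simp only [smul_eq_mul]
    linear_combination (a + b) * hst⟩

theorem concaveOn_curve : ConcaveOn ℝ univ curve := by
  have hA : ConcaveOn ℝ univ fun q : ℝ => 20 / 11 * q := by
    convert concaveOn_line (20 / 11) (-(20 / 11)) using 2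
    ring
  exact (hA.inf (concaveOn_line _ _)).inf ((concaveOn_line _ _).inf (concaveOn_line _ _))

theorem curve_pos {q : ℝ} (hq : q ∈ Ioo (0 : ℝ) 1) : 0 < curve q := by
  obtain ⟨h1, h2⟩ := hq
  exact lt_min (lt_min (by linarith) (by linarith)) (lt_min (by linarith) (by linarith))

theorem curve_le_one (q : ℝ) : curve q ≤ 1 := by
  rcases le_total q (11 / 20) with h | h
  · exact (min_le_left _ _).trans ((min_le_left _ _).trans (by linarith))
  · exact (min_le_left _ _).trans ((min_le_right _ _).trans (by linarith))

/-- The price `R(q) / (1 - q)` is strictly increasing: each of the lines has this property. -/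
theorem curve_mul_lt {p q : ℝ} (hpq : p < q) (hq : q < 1) :
    curve p * (1 - q) < curve q * (1 - p) := by
  have key : ∀ {l m : ℝ}, curve p ≤ l → l * (1 - q) < m * (1 - p) → curve q = m →
      curve p * (1 - q) < curve q * (1 - p) := fun h1 h2 h3 => by
    rw [h3]
    exact (mul_le_mul_of_nonneg_right h1 (by linarith)).trans_lt h2
  have hA : curve p ≤ 20 / 11 * p := (min_le_left _ _).trans (min_le_left _ _)
  have hB : curve p ≤ 0.0847 + 2.034 * (1 - p) := (min_le_left _ _).trans (min_le_right _ _)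
  have hC : curve p ≤ 0.01645 + 4.764 * (1 - p) := (min_le_right _ _).trans (min_le_left _ _)
  have hD : curve p ≤ 0.0015 + 5.96 * (1 - p) := (min_le_right _ _).trans (min_le_right _ _)
  rcases le_total q (11 / 20) with h1 | h1
  · exact key hA (by linarith) (curve_of_le_peak h1)
  rcases le_total q (39 / 40) with h2 | h2
  · exact key hB (by linarith) (curve_of_mem_falling ⟨h1, h2⟩)
  rcases le_total q (79 / 80) with h3 | h3
  · exact key hC (by linarith) (curve_of_mem_steep ⟨h2, h3⟩)
  · exact key hD (by linarith) (curve_of_mem_final h3)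

/-- The price `R(q) / (1 - q)` at the quantile `q`. -/
noncomputable def price (q : ℝ) : ℝ := curve q / (1 - q)

theorem measurable_price : Measurable price :=
  continuous_curve.measurable.div (measurable_const.sub measurable_id)

theorem continuousOn_price : ContinuousOn price (Ioo 0 1) :=
  continuous_curve.continuousOn.div (by fun_prop) fun _ hq => (sub_pos.2 hq.2).ne'

theorem strictMonoOn_price : StrictMonoOn price (Ioo 0 1) := fun p hp q hq hpq => by
  rw [price, price, div_lt_div_iff₀ (sub_pos.2 hp.2) (sub_pos.2 hq.2)]
  exact curve_mul_lt hpq hq.2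

theorem price_mul {q : ℝ} (hq : q ∈ Ioo (0 : ℝ) 1) : price q * (1 - q) = curve q :=
  div_mul_cancel₀ _ (sub_pos.2 hq.2).ne'

theorem price_pos {q : ℝ} (hq : q ∈ Ioo (0 : ℝ) 1) : 0 < price q :=
  div_pos (curve_pos hq) (sub_pos.2 hq.2)

/-! ### The feasible solution of the program -/

/-- The curve is affine on each grid interval, because the lines cross at grid points. -/
theorem curve_add_div {i : ℕ} (hi : i < 80) {t : ℝ} (ht : t ∈ Icc (0 : ℝ) 1) :
    curve ((i + t) / 80) =
      curve ((i : ℕ) / 80) * (1 - t) + curve ((i + 1 : ℕ) / 80) * t := by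
  obtain ⟨h0, h1⟩ := ht
  have hcast : (i : ℝ) + 1 ≤ 80 := by exact_mod_cast hi
  push_cast
  rcases lt_or_ge i 44 with hA | hA
  · have hA' : (i : ℝ) + 1 ≤ 44 := by exact_mod_cast hA
    rw [curve_of_le_peak, curve_of_le_peak, curve_of_le_peak] <;> linarith
  have hA' : (44 : ℝ) ≤ i := by exact_mod_cast hA
  rcases lt_or_ge i 78 with hB | hB
  · have hB' : (i : ℝ) + 1 ≤ 78 := by exact_mod_cast hB
    rw [curve_of_mem_falling, curve_of_mem_falling, curve_of_mem_falling]
    · ring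
    all_goals constructor <;> linarith
  have hB' : (78 : ℝ) ≤ i := by exact_mod_cast hB
  rcases lt_or_ge i 79 with hC | hC
  · have hC' : (i : ℝ) + 1 ≤ 79 := by exact_mod_cast hC
    rw [curve_of_mem_steep, curve_of_mem_steep, curve_of_mem_steep]
    · ring
    all_goals constructor <;> linarith
  have hC' : (79 : ℝ) ≤ i := by exact_mod_cast hC
  rw [curve_of_mem_final, curve_of_mem_final, curve_of_mem_final] <;> linarith

theorem interpolate_curve {q : ℝ} (hq : q ∈ Ioo (0 : ℝ) 1) :
    interpolate 80 (fun i => curve ((i : ℝ) / 80)) q = curve q := by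
  have h0 : 0 ≤ 80 * q := by linarith [hq.1]
  have hi : ⌊80 * q⌋₊ < 80 := by
    rw [Nat.floor_lt h0]
    push_cast
    linarith [hq.2]
  have h1 := Nat.floor_le h0
  have h2 := Nat.lt_floor_add_one (80 * q)
  have h := curve_add_div hi (t := 80 * q - ⌊80 * q⌋₊) ⟨by linarith, by linarith⟩
  rw [show ((⌊80 * q⌋₊ : ℝ) + (80 * q - ⌊80 * q⌋₊)) / 80 = q by ring] at h
  rw [h, interpolate]
  push_cast
  rfl

theorem midpt_eq (i : ℕ) : midpt 80 i = ((i : ℝ) + 1 / 2) / 80 := by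
  rw [midpt, node, node]
  push_cast
  ring

theorem midpt_mem {i : ℕ} (hi : i < 80) : midpt 80 i ∈ Ioo (0 : ℝ) 1 := by
  have hcast : (i : ℝ) + 1 ≤ 80 := by exact_mod_cast hi
  have h0 : (0 : ℝ) ≤ i := i.cast_nonneg
  rw [midpt_eq]
  constructor <;> linarith

theorem price_midpt_mono {i j : ℕ} (hij : i ≤ j) (hj : j < 80) :
    price (midpt 80 i) ≤ price (midpt 80 j) := by
  refine (strictMonoOn_price.le_iff_le (midpt_mem (hij.trans_lt hj)) (midpt_mem hj)).2 ?_
  have hcast : (i : ℝ) ≤ j := by exact_mod_cast hij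
  rw [midpt_eq, midpt_eq]
  linarith

open Classical in
/-- The solution given by the curve: `w i j` says whether the price at the midpoint of interval `i`
is at least twice that of interval `j`, and `Rw` is the exact product of the two factors. -/
noncomputable def solution : MILPPoint where
  R i := curve ((i : ℝ) / 80)
  w i j := if 2 * price (midpt 80 j) ≤ price (midpt 80 i) then 1 else 0
  Rw l i j := if 2 * price (midpt 80 j) ≤ price (midpt 80 i) then curve (midpt 80 l) else 0

theorem solution_Rmid {i : ℕ} (hi : i < 80) : solution.Rmid i = curve (midpt 80 i) := by
  rw [midpt_eq, curve_add_div hi ⟨by norm_num, by norm_num⟩, MILPPoint.Rmid]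
  simp only [solution]
  ring

theorem solution_feasible : solution.Feasible 80 44 where
  concave i _ := by
    have h := concaveOn_curve.2 (mem_univ ((i : ℝ) / 80)) (mem_univ (((i : ℝ) + 2) / 80))
      (by norm_num : (0 : ℝ) ≤ 1 / 2) (by norm_num : (0 : ℝ) ≤ 1 / 2) (by norm_num)
    simp only [smul_eq_mul] at h
    rw [show 1 / 2 * ((i : ℝ) / 80) + 1 / 2 * (((i : ℝ) + 2) / 80) = (i + 1) / 80 by ring] at h
    simp only [solution, node]
    push_cast
    linarith
  w_one i j hji hi := by
    have hj := midpt_mem (hji.trans hi)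
    have hi := midpt_mem hi
    simp only [solution]
    split_ifs with h
    · rw [price, price, ← mul_div_assoc, div_le_div_iff₀ (sub_pos.2 hj.2) (sub_pos.2 hi.2)] at h
      linarith
    · simp
  w_zero i j hji hi := by
    rw [solution_Rmid hi, solution_Rmid (hji.trans hi)]
    have hj := midpt_mem (hji.trans hi)
    have hi := midpt_mem hi
    simp only [solution]
    split_ifs with h
    · simp
    · rw [not_le, price, price, ← mul_div_assoc,
        div_lt_div_iff₀ (sub_pos.2 hi.2) (sub_pos.2 hj.2)] at h
      linarith
  Rw_le_w i j l _ _ _ := by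
    simp only [solution]
    split_ifs
    exacts [curve_le_one _, le_rfl]
  Rw_le_R i j l hji hi hl := by
    have hl : l < 80 := by omega
    rw [solution_Rmid hl]
    simp only [solution]
    split_ifs
    exacts [le_rfl, (curve_pos (midpt_mem hl)).le]
  le_Rw i j l hji hi hl := by
    have hl : l < 80 := by omega
    rw [solution_Rmid hl]
    have := curve_le_one (midpt 80 l)
    simp only [solution]
    split_ifs <;> linarith
  w_mono_left i j _ hi := by
    have h := price_midpt_mono i.le_succ hi
    simp only [solution]
    split_ifs with h1 h2
    exacts [le_rfl, absurd (h1.trans h) h2, zero_le_one, le_rfl]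
  w_mono_right i j hji hi := by
    have h := price_midpt_mono j.le_succ (by omega : j + 1 < 80)
    simp only [solution]
    split_ifs with h1 h2
    exacts [le_rfl, absurd ((mul_le_mul_of_nonneg_left h zero_le_two).trans h1) h2,
      zero_le_one, le_rfl]
  peak_le := by norm_num
  peak := by
    simp only [solution]
    rw [curve_of_le_peak] <;> norm_num
  R_mem i hi := by
    refine ⟨?_, curve_le_one _⟩
    have h0 : (0 : ℝ) ≤ i := i.cast_nonneg
    have h1 : (i : ℝ) ≤ 80 := by exact_mod_cast hi
    exact le_min (le_min (by linarith) (by linarith)) (le_min (by linarith) (by linarith))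
  w_binary i j _ _ := by
    simp only [solution]
    split_ifs <;> simp
  Rw_mem i j l hji hi hl := by
    have hl : l < 80 := by omega
    simp only [solution]
    split_ifs
    exacts [⟨(curve_pos (midpt_mem hl)).le, curve_le_one _⟩, by simp]

theorem abs_solution_sub_reportedCurve_le {i : ℕ} (hi : i ≤ 80) :
    |solution.R i - reportedCurve i| ≤ 1 / 1000 := by
  have h0 : (0 : ℝ) ≤ i := i.cast_nonneg
  have hcast : (i : ℝ) ≤ 80 := by exact_mod_cast hi
  simp only [solution]
  rw [abs_le, reportedCurve]
  split_ifs with h1 h2 h3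
  · have h1' : (i : ℝ) ≤ 44 := by exact_mod_cast h1
    rw [curve_of_le_peak (by linarith)]
    constructor <;> linarith
  · have h1' : (44 : ℝ) ≤ i := by exact_mod_cast (not_le.1 h1).le
    have h2' : (i : ℝ) ≤ 78 := by exact_mod_cast h2
    rw [curve_of_mem_falling ⟨by linarith, by linarith⟩]
    constructor <;> linarith
  · subst h3
    rw [curve_of_mem_final (by norm_num)]
    norm_num
  · obtain rfl : i = 80 := by omega
    rw [curve_of_mem_final (by norm_num)]
    norm_num

/-! ### The contribution of a range of lower quantiles -/

theorem price_mul_le_one {q : ℝ} (hq : q ∈ Ioo (0 : ℝ) 1) : price q * (1 - q) ≤ 1 :=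
  (price_mul hq).trans_le (curve_le_one q)

/-- The conditional contribution of the lower quantile `y` when `c` is the quantile at which the
price is twice that at `y`. -/
theorem integral_orderedRevenue_price_le {y c : ℝ} (hy : y ∈ Ioo (0 : ℝ) 1)
    (hc : c ∈ Ioo (0 : ℝ) 1) (h : curve c * (1 - y) = 2 * curve y * (1 - c)) :
    ∫ x in (0 : ℝ)..1, orderedRevenue price x y ≤ (c - y) * curve y + ∫ x in c..1, curve x := by
  have hprice : price c = 2 * price y := by
    rw [price, price, ← mul_div_assoc, div_eq_div_iff (sub_pos.2 hc.2).ne' (sub_pos.2 hy.2).ne', h]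
  have hyc : y < c := (strictMonoOn_price.lt_iff_lt hy hc).1 (by linarith [price_pos hy])
  refine integral_orderedRevenue_le continuous_curve measurable_price (fun q hq => (price_pos hq).le)
    (fun q hq => price_mul_le_one hq) hy hyc.le hc.2.le (fun x hx => ?_) (fun x hx => ?_)
  · have hx1 : x ∈ Ioo (0 : ℝ) 1 := ⟨hy.1.trans hx.1, hx.2.trans hc.2⟩
    have := strictMonoOn_price hx1 hc hx.2
    rw [orderedRevenue, if_neg hx.1.not_gt, if_neg (by linarith), price_mul hy]
  · have hx1 : x ∈ Ioo (0 : ℝ) 1 := ⟨hc.1.trans hx.1, hx.2⟩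
    have := strictMonoOn_price hc hx1 hx.1
    rw [orderedRevenue, if_neg (hyc.trans hx.1).not_gt, if_pos (by linarith), price_mul hx1]

/-- Past the peak the curve decreases, so that the conditional contribution of the lower quantile `y`
is at most its own revenue, weighted with the probability of a higher quantile. Beyond `39/40` this
loses little, and the steep line is used as a bound for the revenue. -/
theorem integral_orderedRevenue_price_le_of_steep {y : ℝ} (hy : y ∈ Ioo (39 / 40 : ℝ) 1) :
    ∫ x in (0 : ℝ)..1, orderedRevenue price x y ≤
      (1 - y) * (0.01645 + 4.764 * (1 - y)) := by
  have hy' : y ∈ Ioo (0 : ℝ) 1 := ⟨by linarith [hy.1], hy.2⟩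
  have hanti : ∀ x ∈ Ioo y 1, curve x ≤ curve y := fun x hx => by
    have hC : curve x ≤ 0.01645 + 4.764 * (1 - x) := (min_le_right _ _).trans (min_le_left _ _)
    have hD : curve x ≤ 0.0015 + 5.96 * (1 - x) := (min_le_right _ _).trans (min_le_right _ _)
    rcases le_total y (79 / 80) with h | h
    · rw [curve_of_mem_steep ⟨hy.1.le, h⟩]
      linarith [hx.1]
    · rw [curve_of_mem_final h]
      linarith [hx.1]
  have hmain := integral_orderedRevenue_le continuous_curve measurable_price
    (fun q hq => (price_pos hq).le) (fun q hq => price_mul_le_one hq) hy' hy.2.le le_rfl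
    (fun x hx => ?_) (fun x hx => absurd hx.1 hx.2.not_gt)
  · rw [intervalIntegral.integral_same, add_zero] at hmain
    have hC : curve y ≤ 0.01645 + 4.764 * (1 - y) := (min_le_right _ _).trans (min_le_left _ _)
    exact hmain.trans (mul_le_mul_of_nonneg_left hC (by linarith [hy.2]))
  · have hx1 : x ∈ Ioo (0 : ℝ) 1 := ⟨hy'.1.trans hx.1, hx.2⟩
    rw [orderedRevenue, if_neg hx.1.not_gt, price_mul hx1, price_mul hy']
    split_ifs
    exacts [hanti x hx, le_rfl]

theorem intervalIntegrable_conditional {l r : ℝ} (hl : 0 ≤ l) (hlr : l ≤ r) (hr : r ≤ 1) :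
    IntervalIntegrable (fun y => ∫ x in (0 : ℝ)..1, orderedRevenue price x y) volume l r :=
  (intervalIntegrable_integral_orderedRevenue measurable_price (fun _ hq => (price_pos hq).le)
    (fun _ hq => price_mul_le_one hq)).mono_set
      (by rw [uIcc_of_le hlr, uIcc_of_le zero_le_one]; exact Icc_subset_Icc hl hr)

/-- The value of `∫ ((u - w) (a + b u) + C + a' w + b' w² / 2) du` over `u` from `V` to `U`, where
`w = a' u / (k u + m)` with `k = 2 b - b'` and `m = 2 a`. Here `L` stands for
`log ((k U + m) / (k V + m))`. -/
noncomputable def pieceValue (a b a' b' C U V L : ℝ) : ℝ :=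
  let k := 2 * b - b'
  let m := 2 * a
  C * (U - V) + (a - a' / 2) / 2 * (U ^ 2 - V ^ 2) + b / 3 * (U ^ 3 - V ^ 3)
    + a' * (a' / k) * ((U - V) - m / k * L)
    - b' / 2 * (a' / k) * ((U ^ 2 - V ^ 2) / 2 - m / k * (U - V) + m ^ 2 / k ^ 2 * L)
    + b' / 2 * (a' / k) ^ 2 *
      ((U - V) - 2 * (m / k) * L - m ^ 2 / k * (1 / (k * U + m) - 1 / (k * V + m)))

theorem integral_eq_pieceValue {a b a' b' C l r : ℝ} (hk : 2 * b - b' ≠ 0) (hlr : l ≤ r)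
    (hpos : ∀ y ∈ Icc l r, 0 < (2 * b - b') * (1 - y) + 2 * a) :
    ∫ y in l..r, ((1 - y - a' * (1 - y) / ((2 * b - b') * (1 - y) + 2 * a)) * (a + b * (1 - y))
      + (C + a' * (a' * (1 - y) / ((2 * b - b') * (1 - y) + 2 * a))
        + b' / 2 * (a' * (1 - y) / ((2 * b - b') * (1 - y) + 2 * a)) ^ 2)) =
    pieceValue a b a' b' C (1 - l) (1 - r)
      (Real.log (((2 * b - b') * (1 - l) + 2 * a) / ((2 * b - b') * (1 - r) + 2 * a))) := by
  have hDl := hpos l (left_mem_Icc.2 hlr)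
  have hDr := hpos r (right_mem_Icc.2 hlr)
  rw [Real.log_div hDl.ne' hDr.ne']
  set k := 2 * b - b' with hkdef
  set m := 2 * a with hm
  let Φ : ℝ → ℝ := fun y => -(C * (1 - y) + (a - a' / 2) / 2 * (1 - y) ^ 2 + b / 3 * (1 - y) ^ 3
    + a' * (a' / k) * ((1 - y) - m / k * Real.log (k * (1 - y) + m))
    - b' / 2 * (a' / k) * ((1 - y) ^ 2 / 2 - m / k * (1 - y)
      + m ^ 2 / k ^ 2 * Real.log (k * (1 - y) + m))
    + b' / 2 * (a' / k) ^ 2 * ((1 - y) - 2 * (m / k) * Real.log (k * (1 - y) + m)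
      - m ^ 2 / k * (k * (1 - y) + m)⁻¹))
  have hderiv : ∀ y ∈ uIcc l r, HasDerivAt Φ
      ((1 - y - a' * (1 - y) / (k * (1 - y) + m)) * (a + b * (1 - y))
      + (C + a' * (a' * (1 - y) / (k * (1 - y) + m))
        + b' / 2 * (a' * (1 - y) / (k * (1 - y) + m)) ^ 2)) y := by
    intro y hy
    rw [uIcc_of_le hlr] at hy
    have hD := (hpos y hy).ne'
    have hu : HasDerivAt (fun y : ℝ => 1 - y) (-1) y := by
      simpa using (hasDerivAt_id y).const_sub 1
    have hDd := (hu.const_mul k).add_const m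
    have hlog := hDd.log hD
    have hinv := hDd.inv hD
    refine HasDerivAt.congr_deriv (f := Φ) ((((((hu.const_mul C).add
      ((hu.pow 2).const_mul ((a - a' / 2) / 2))).add
      ((hu.pow 3).const_mul (b / 3))).add
      ((hu.sub (hlog.const_mul (m / k))).const_mul (a' * (a' / k)))).sub
      (((((hu.pow 2).div_const 2).sub (hu.const_mul (m / k))).add
        (hlog.const_mul (m ^ 2 / k ^ 2))).const_mul (b' / 2 * (a' / k)))).add
      (((hu.sub (hlog.const_mul (2 * (m / k)))).sub (hinv.const_mul (m ^ 2 / k))).const_mul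
        (b' / 2 * (a' / k) ^ 2))).neg ?_
    -- a polynomial identity once everything is written in terms of the denominator `E`
    generalize hE : k * (1 - y) + m = E at hD ⊢
    have hu' : 1 - y = (E - m) / k := by
      rw [← hE]
      field_simp
      ring
    have ha : a = m / 2 := by rw [hm]; ring
    have hb : b = (k + b') / 2 := by rw [hkdef]; ring
    rw [hu', ha, hb]
    simp only [Nat.cast_ofNat, Nat.reduceSub, pow_one]
    field_simp
    ring
  rw [intervalIntegral.integral_eq_sub_of_hasDerivAt hderiv]
  · simp only [Φ, pieceValue, ← hkdef, ← hm]
    ring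
  · refine ContinuousOn.intervalIntegrable fun y hy => ContinuousAt.continuousWithinAt ?_
    rw [uIcc_of_le hlr] at hy
    have hD := (hpos y hy).ne'
    fun_prop (disch := exact hD)

/-- The total contribution of the lower quantiles in `[l, r]`, if the curve is the line
`a + b (1 - q)` there and the line `a' + b' (1 - q)` on an interval `[p, q]` that contains the
quantiles at which the price is twice as high. For the lower quantile `1 - u` this is the quantile
`1 - w` with `w = a' u / ((2 b - b') u + 2 a)`, and `hcut` says that it lies in `[p, q]`. -/
theorem integral_conditional_le_pieceValue {a b a' b' C l r p q : ℝ}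
    (hk : 2 * b - b' ≠ 0) (hl : 0 ≤ l) (hlr : l ≤ r) (hr : r ≤ 1) (hp : 0 ≤ p) (hq : q ≤ 1)
    (hpos : ∀ y ∈ Icc l r, 0 < (2 * b - b') * (1 - y) + 2 * a)
    (hcurve : ∀ y ∈ Icc l r, curve y = a + b * (1 - y))
    (hcurve' : ∀ c ∈ Icc p q, curve c = a' + b' * (1 - c))
    (htail : ∀ c ∈ Icc p q, ∫ x in c..1, curve x = C + a' * (1 - c) + b' / 2 * (1 - c) ^ 2)
    (hcut : ∀ y ∈ Ioo l r, (1 - q) * ((2 * b - b') * (1 - y) + 2 * a) < a' * (1 - y) ∧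
      a' * (1 - y) < (1 - p) * ((2 * b - b') * (1 - y) + 2 * a)) :
    ∫ y in l..r, (∫ x in (0 : ℝ)..1, orderedRevenue price x y) ≤
      pieceValue a b a' b' C (1 - l) (1 - r)
        (Real.log (((2 * b - b') * (1 - l) + 2 * a) / ((2 * b - b') * (1 - r) + 2 * a))) := by
  rw [← integral_eq_pieceValue hk hlr hpos]
  refine intervalIntegral.integral_mono_on_of_le_Ioo hlr (intervalIntegrable_conditional hl hlr hr)
    ?_ fun y hy => ?_
  · refine ContinuousOn.intervalIntegrable fun y hy => ContinuousAt.continuousWithinAt ?_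
    rw [uIcc_of_le hlr] at hy
    have hD := (hpos y hy).ne'
    fun_prop (disch := exact hD)
  have hyI : y ∈ Icc l r := Ioo_subset_Icc_self hy
  have hD := hpos y hyI
  obtain ⟨h1, h2⟩ := hcut y hy
  rw [← lt_div_iff₀ hD] at h1
  rw [← div_lt_iff₀ hD] at h2
  have hwD : a' * (1 - y) / ((2 * b - b') * (1 - y) + 2 * a) * ((2 * b - b') * (1 - y) + 2 * a)
      = a' * (1 - y) := div_mul_cancel₀ _ hD.ne'
  generalize a' * (1 - y) / ((2 * b - b') * (1 - y) + 2 * a) = w at h1 h2 hwD ⊢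
  have hcI : 1 - w ∈ Icc p q := ⟨by linarith, by linarith⟩
  have hmain := integral_orderedRevenue_price_le (y := y) (c := 1 - w)
    ⟨hl.trans_lt hy.1, hy.2.trans_le hr⟩ ⟨by linarith, by linarith⟩ <| by
      rw [hcurve y hyI, hcurve' _ hcI]
      linear_combination -hwD
  rw [htail _ hcI, hcurve y hyI] at hmain
  refine hmain.trans_eq ?_
  ring

/-! ### Tails of the revenue curve -/

theorem integral_curve_eq_of_line {a b c d : ℝ} (hcd : c ≤ d)
    (h : ∀ x ∈ Icc c d, curve x = a + b * (1 - x)) :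
    ∫ x in c..d, curve x = a * (d - c) + b / 2 * ((1 - c) ^ 2 - (1 - d) ^ 2) := by
  rw [intervalIntegral.integral_congr (g := fun x => a + b * (1 - x))
    (fun x hx => h x (by rwa [uIcc_of_le hcd] at hx))]
  rw [intervalIntegral.integral_eq_sub_of_hasDerivAt
    (f := fun x => a * x - b / 2 * (1 - x) ^ 2)]
  · ring
  · intro x _
    have hu : HasDerivAt (fun y : ℝ => 1 - y) (-1) x := by
      simpa using (hasDerivAt_id x).const_sub 1
    refine (((hasDerivAt_id x).const_mul a).sub ((hu.pow 2).const_mul (b / 2))).congr_deriv ?_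
    push_cast
    ring
  · exact Continuous.intervalIntegrable (by fun_prop) _ _

theorem integral_curve_split (c d : ℝ) :
    ∫ x in c..1, curve x = (∫ x in c..d, curve x) + ∫ x in d..1, curve x :=
  (intervalIntegral.integral_add_adjacent_intervals (continuous_curve.intervalIntegrable _ _)
    (continuous_curve.intervalIntegrable _ _)).symm

theorem integral_curve_final {c : ℝ} (hc : c ∈ Icc (79 / 80 : ℝ) 1) :
    ∫ x in c..1, curve x = 0 + 0.0015 * (1 - c) + 5.96 / 2 * (1 - c) ^ 2 := by
  rw [integral_curve_eq_of_line hc.2 fun x hx => curve_of_mem_final (hc.1.trans hx.1)]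
  ring

theorem integral_curve_steep {c : ℝ} (hc : c ∈ Icc (39 / 40 : ℝ) (79 / 80)) :
    ∫ x in c..1, curve x = -0.0000934375 + 0.01645 * (1 - c) + 4.764 / 2 * (1 - c) ^ 2 := by
  rw [integral_curve_split c (79 / 80), integral_curve_final ⟨le_rfl, by norm_num⟩,
    integral_curve_eq_of_line hc.2 fun x hx => curve_of_mem_steep ⟨hc.1.trans hx.1, hx.2⟩]
  ring

theorem integral_curve_falling {c : ℝ} (hc : c ∈ Icc (11 / 20 : ℝ) (39 / 40)) :
    ∫ x in c..1, curve x = -0.0009465625 + 0.0847 * (1 - c) + 2.034 / 2 * (1 - c) ^ 2 := by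
  rw [integral_curve_split c (39 / 40), integral_curve_steep ⟨le_rfl, by norm_num⟩,
    integral_curve_eq_of_line hc.2 fun x hx => curve_of_mem_falling ⟨hc.1.trans hx.1, hx.2⟩]
  ring

theorem curve_of_le_peak_eq_line {q : ℝ} (h : q ≤ 11 / 20) :
    curve q = 20 / 11 + -20 / 11 * (1 - q) := by
  rw [curve_of_le_peak h]
  ring

theorem integral_curve_rising {c : ℝ} (hc : c ∈ Icc (0 : ℝ) (11 / 20)) :
    ∫ x in c..1, curve x =
      -2752499 / 7040000 + 20 / 11 * (1 - c) + (-20 / 11) / 2 * (1 - c) ^ 2 := by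
  rw [integral_curve_split c (11 / 20), integral_curve_falling ⟨le_rfl, by norm_num⟩,
    integral_curve_eq_of_line hc.2 fun x hx => curve_of_le_peak_eq_line hx.2]
  ring

/-! ### Numerical evaluation -/

/-- The lower half of the `artanh` series bounds for the logarithm. -/
theorem two_mul_sum_le_log {x : ℝ} (h0 : 0 ≤ x) (h1 : x < 1) (n : ℕ) :
    2 * ∑ i ∈ Finset.range n, x ^ (2 * i + 1) / (2 * i + 1) ≤ Real.log ((1 + x) / (1 - x)) := by
  linarith [Real.sum_range_le_log_div h0 h1 n]

theorem le_log_rising_rising : -0.32158364 ≤ Real.log (29 / 40) := by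
  rw [← inv_div, Real.log_inv]
  have h := Real.log_div_le_sum_range_add (x := 11 / 69) (by norm_num) (by norm_num) 5
  norm_num [Finset.sum_range_succ] at h
  linarith

theorem log_rising_falling_le : Real.log (33880 / 314563) ≤ -2.2282 := by
  -- a power of two is split off because the series converges slowly for large ratios
  rw [← inv_div, Real.log_inv]
  have h := two_mul_sum_le_log (x := 321 / 4321) (by norm_num) (by norm_num) 3
  have h2 := Real.log_two_gt_d9
  have hsplit : Real.log (2 ^ 3 * (2321 / 2000)) = 3 * Real.log 2 + Real.log (2321 / 2000) := by
    rw [Real.log_mul (by norm_num) (by norm_num), Real.log_pow]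
    norm_num
  have hle : Real.log (2 ^ 3 * (2321 / 2000)) ≤ Real.log (314563 / 33880) :=
    Real.log_le_log (by norm_num) (by norm_num)
  norm_num [Finset.sum_range_succ] at h
  linarith

theorem le_log_falling_falling : 0.9395 ≤ Real.log (7343419 / 2869636) := by
  have h := two_mul_sum_le_log (x := 1559 / 3559) (by norm_num) (by norm_num) 6
  have hle : Real.log (2559 / 1000) ≤ Real.log (7343419 / 2869636) :=
    Real.log_le_log (by norm_num) (by norm_num)
  norm_num [Finset.sum_range_succ] at h
  linarith

theorem log_falling_steep_le : Real.log (503 / 677) ≤ -0.29707 := by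
  rw [← inv_div, Real.log_inv]
  have h := two_mul_sum_le_log (x := 87 / 590) (by norm_num) (by norm_num) 3
  norm_num [Finset.sum_range_succ] at h
  linarith

theorem log_falling_final_le : Real.log (1540 / 18611) ≤ -2.479 := by
  rw [← inv_div, Real.log_inv]
  have h := two_mul_sum_le_log (x := 1 / 5) (by norm_num) (by norm_num) 1
  have h2 := Real.log_two_gt_d9
  have hsplit : Real.log (2 ^ 3 * (3 / 2)) = 3 * Real.log 2 + Real.log (3 / 2) := by
    rw [Real.log_mul (by norm_num) (by norm_num), Real.log_pow]
    norm_num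
  have hle : Real.log (2 ^ 3 * (3 / 2)) ≤ Real.log (18611 / 1540) :=
    Real.log_le_log (by norm_num) (by norm_num)
  norm_num at h
  linarith

/- The lower quantiles are cut at the crossings of the lines and at the quantiles where twice the
price reaches the price at a crossing; the two words in a name are the lines at the lower quantile
and at the quantile with twice its price. -/

theorem integral_conditional_rising_rising :
    ∫ y in (0 : ℝ)..11 / 29, (∫ x in (0 : ℝ)..1, orderedRevenue price x y) ≤ 0.1746078 := by
  refine (integral_conditional_le_pieceValue (a := 20 / 11) (b := -20 / 11) (a' := 20 / 11)
    (b' := -20 / 11) (C := -2752499 / 7040000) (p := 0) (q := 11 / 20) (by norm_num) (by norm_num)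
    (by norm_num) (by norm_num) (by norm_num) (by norm_num) (fun y hy => by linarith [hy.1])
    (fun y hy => curve_of_le_peak_eq_line (by linarith [hy.2]))
    (fun c hc => curve_of_le_peak_eq_line hc.2)
    (fun c hc => integral_curve_rising hc)
    (fun y hy => ⟨by linarith [hy.2], by linarith [hy.1]⟩)).trans ?_
  have hlog := le_log_rising_rising
  norm_num [pieceValue]
  linarith

theorem integral_conditional_rising_falling :
    ∫ y in (11 / 29 : ℝ)..11 / 20, (∫ x in (0 : ℝ)..1, orderedRevenue price x y) ≤ 0.0665678 := by
  refine (integral_conditional_le_pieceValue (a := 20 / 11) (b := -20 / 11) (a' := 0.0847)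
    (b' := 2.034) (C := -0.0009465625) (p := 11 / 20) (q := 39 / 40) (by norm_num) (by norm_num)
    (by norm_num) (by norm_num) (by norm_num) (by norm_num) (fun y hy => by linarith [hy.1])
    (fun y hy => curve_of_le_peak_eq_line hy.2) (fun c hc => curve_of_mem_falling hc)
    (fun c hc => integral_curve_falling hc)
    (fun y hy => ⟨by linarith [hy.1, hy.2], by linarith [hy.1, hy.2]⟩)).trans ?_
  have hlog := log_rising_falling_le
  norm_num [pieceValue]
  linarith

theorem integral_conditional_falling_falling :
    ∫ y in (11 / 20 : ℝ)..5923 / 6770, (∫ x in (0 : ℝ)..1, orderedRevenue price x y) ≤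
      0.0622202 := by
  refine (integral_conditional_le_pieceValue (a := 0.0847) (b := 2.034) (a' := 0.0847)
    (b' := 2.034) (C := -0.0009465625) (p := 11 / 20) (q := 39 / 40) (by norm_num) (by norm_num)
    (by norm_num) (by norm_num) (by norm_num) (by norm_num)
    (fun y hy => by linarith [hy.1, hy.2])
    (fun y hy => curve_of_mem_falling ⟨hy.1, by linarith [hy.2]⟩)
    (fun c hc => curve_of_mem_falling hc) (fun c hc => integral_curve_falling hc)
    (fun y hy => ⟨by linarith [hy.1, hy.2], by linarith [hy.1, hy.2]⟩)).trans ?_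
  have hlog := le_log_falling_falling
  norm_num [pieceValue]
  linarith

theorem integral_conditional_falling_steep :
    ∫ y in (5923 / 6770 : ℝ)..9213 / 10060, (∫ x in (0 : ℝ)..1, orderedRevenue price x y) ≤
      0.0011033 := by
  refine (integral_conditional_le_pieceValue (a := 0.0847) (b := 2.034) (a' := 0.01645)
    (b' := 4.764) (C := -0.0000934375) (p := 39 / 40) (q := 79 / 80) (by norm_num) (by norm_num)
    (by norm_num) (by norm_num) (by norm_num) (by norm_num)
    (fun y hy => by linarith [hy.1, hy.2])
    (fun y hy => curve_of_mem_falling ⟨by linarith [hy.1], by linarith [hy.2]⟩)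
    (fun c hc => curve_of_mem_steep hc) (fun c hc => integral_curve_steep hc)
    (fun y hy => ⟨by linarith [hy.1, hy.2], by linarith [hy.1, hy.2]⟩)).trans ?_
  have hlog := log_falling_steep_le
  norm_num [pieceValue]
  linarith

theorem integral_conditional_falling_final :
    ∫ y in (9213 / 10060 : ℝ)..39 / 40, (∫ x in (0 : ℝ)..1, orderedRevenue price x y) ≤
      0.0006407 := by
  refine (integral_conditional_le_pieceValue (a := 0.0847) (b := 2.034) (a' := 0.0015)
    (b' := 5.96) (C := 0) (p := 79 / 80) (q := 1) (by norm_num) (by norm_num)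
    (by norm_num) (by norm_num) (by norm_num) (by norm_num)
    (fun y hy => by linarith [hy.1, hy.2])
    (fun y hy => curve_of_mem_falling ⟨by linarith [hy.1], by linarith [hy.2]⟩)
    (fun c hc => curve_of_mem_final hc.1) (fun c hc => integral_curve_final hc)
    (fun y hy => ⟨by linarith [hy.1, hy.2], by linarith [hy.1, hy.2]⟩)).trans ?_
  have hlog := log_falling_final_le
  norm_num [pieceValue]
  linarith

theorem integral_conditional_tail :
    ∫ y in (39 / 40 : ℝ)..1, (∫ x in (0 : ℝ)..1, orderedRevenue price x y) ≤ 0.00003 := by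
  have h := intervalIntegral.integral_mono_on_of_le_Ioo (by norm_num : (39 / 40 : ℝ) ≤ 1)
    (intervalIntegrable_conditional (by norm_num) (by norm_num) le_rfl)
    (Continuous.intervalIntegrable (by fun_prop) _ _)
    (fun y hy => integral_orderedRevenue_price_le_of_steep hy)
  refine h.trans ?_
  rw [intervalIntegral.integral_comp_sub_left (fun u : ℝ => u * (0.01645 + 4.764 * u)) 1]
  have e : (fun u : ℝ => u * (0.01645 + 4.764 * u)) = fun u => 0.01645 * u + 4.764 * u ^ 2 := by
    funext u
    ring
  rw [e, intervalIntegral.integral_add (Continuous.intervalIntegrable (by fun_prop) _ _)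
    (Continuous.intervalIntegrable (by fun_prop) _ _), intervalIntegral.integral_const_mul,
    intervalIntegral.integral_const_mul, integral_id, integral_pow]
  norm_num

theorem ermRevenue_price_le : ermRevenue (quantileLaw price) ≤ 0.61035 := by
  have hmain := ermRevenue_quantileLaw_le measurable_price strictMonoOn_price
    (fun _ hq => (price_pos hq).le) (fun _ hq => price_mul_le_one hq)
  have i1 := intervalIntegrable_conditional (l := 0) (r := 11 / 29) (by norm_num) (by norm_num)
    (by norm_num)
  have i2 := intervalIntegrable_conditional (l := 11 / 29) (r := 11 / 20) (by norm_num)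
    (by norm_num) (by norm_num)
  have i3 := intervalIntegrable_conditional (l := 11 / 20) (r := 5923 / 6770) (by norm_num)
    (by norm_num) (by norm_num)
  have i4 := intervalIntegrable_conditional (l := 5923 / 6770) (r := 9213 / 10060) (by norm_num)
    (by norm_num) (by norm_num)
  have i5 := intervalIntegrable_conditional (l := 9213 / 10060) (r := 39 / 40) (by norm_num)
    (by norm_num) (by norm_num)
  have i6 := intervalIntegrable_conditional (l := 39 / 40) (r := 1) (by norm_num) (by norm_num)
    (by norm_num)
  rw [← intervalIntegral.integral_add_adjacent_intervals ((((i1.trans i2).trans i3).trans i4).trans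
      i5) i6,
    ← intervalIntegral.integral_add_adjacent_intervals (((i1.trans i2).trans i3).trans i4) i5,
    ← intervalIntegral.integral_add_adjacent_intervals ((i1.trans i2).trans i3) i4,
    ← intervalIntegral.integral_add_adjacent_intervals (i1.trans i2) i3,
    ← intervalIntegral.integral_add_adjacent_intervals i1 i2] at hmain
  linarith [integral_conditional_rising_rising, integral_conditional_rising_falling,
    integral_conditional_falling_falling, integral_conditional_falling_steep,
    integral_conditional_falling_final, integral_conditional_tail]

/-! ### The distribution -/

theorem revenueCurve_quantileLaw_price {q : ℝ} (hq : q ∈ Ioo (0 : ℝ) 1) :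
    revenueCurve (quantileLaw price) q = curve q := by
  rw [revenueCurve, priceInverse_quantileLaw measurable_price strictMonoOn_price
    continuousOn_price hq, mul_comm, price_mul hq]

theorem isRegular_quantileLaw_price : IsRegular (quantileLaw price) := by
  refine ⟨isValuation_quantileLaw measurable_price fun _ hq => (price_pos hq).le, ?_⟩
  exact (concaveOn_curve.subset (subset_univ _) (convex_Ioo 0 1)).congr fun q hq =>
    (revenueCurve_quantileLaw_price hq).symm

theorem isGreatest_priceRevenue_one :
    IsGreatest (priceRevenue (quantileLaw price) '' Ici 0) 1 := by
  have hpeak : (11 / 20 : ℝ) ∈ Ioo (0 : ℝ) 1 := by norm_num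
  refine ⟨⟨price (11 / 20), (price_pos hpeak).le, ?_⟩, ?_⟩
  · rw [priceRevenue_quantileLaw_apply measurable_price strictMonoOn_price hpeak, price_mul hpeak,
      curve_of_le_peak le_rfl]
    norm_num
  · rintro _ ⟨p, _, rfl⟩
    exact priceRevenue_quantileLaw_le_one measurable_price (fun _ hq => price_mul_le_one hq) p

end TwoSampleERM

theorem mainTheorem6 :
    ∃ s : TwoSampleERM.MILPPoint,
      s.Feasible 80 44 ∧
      (∀ i : ℕ, i ≤ 80 → |s.R i - TwoSampleERM.reportedCurve i| ≤ 1 / 1000) ∧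
      ∃ F : Measure ℝ,
        TwoSampleERM.IsRegular F ∧
        (∀ x : ℝ, F {x} = 0) ∧
        (∀ q ∈ Ioo (0 : ℝ) 1,
          TwoSampleERM.revenueCurve F q = TwoSampleERM.interpolate 80 s.R q) ∧
        0 < TwoSampleERM.optimalRevenue F ∧
        IsGreatest (TwoSampleERM.priceRevenue F '' Ici 0) (TwoSampleERM.optimalRevenue F) ∧
        Integrable (fun z : ℝ × ℝ => TwoSampleERM.bisampleRevenue F z.1 z.2) (F.prod F) ∧
        TwoSampleERM.ermRevenue F ≤ 0.61035 * TwoSampleERM.optimalRevenue F := by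
  open TwoSampleERM in
  have hopt : optimalRevenue (quantileLaw price) = 1 := isGreatest_priceRevenue_one.csSup_eq
  refine ⟨solution, solution_feasible, fun i hi => abs_solution_sub_reportedCurve_le hi,
    quantileLaw price, isRegular_quantileLaw_price,
    quantileLaw_singleton measurable_price strictMonoOn_price,
    fun q hq => (revenueCurve_quantileLaw_price hq).trans (interpolate_curve hq).symm, ?_, ?_,
    integrable_bisampleRevenue measurable_price (fun _ hq => (price_pos hq).le)
      (fun _ hq => price_mul_le_one hq), ?_⟩
  · rw [hopt]
    exact one_pos
  · rw [hopt]
    exact isGreatest_priceRevenue_one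
  · rw [hopt, mul_one]
    exact ermRevenue_price_le
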